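/- **Setting** ($\hbar=1$). The system $\mathcal S$ has a finite-dimensional Hilbert space with Hamiltonian $\hat H_S=\sum_i \epsilon_i |\epsilon_i\rangle\langle\epsilon_i|$, where $(|\epsilon_i\rangle)_i$ is an orthonormal basis. The quantum weight $\mathcal W$ has Hilbert space $L^2(\mathbb R)$, its Hamiltonian $\hat H_W$ is multiplication by the energy variable $E$, and the time operator is $\hat\Delta_W=-i\,\frac{d}{dE}$, so that $[\hat H_W,\hat\Delta_W]=i$ and $(e^{-i a\hat\Delta_W}\psi)(E)=\psi(E-a)$. The (generalized) eigenstates of $\hat\Delta_W$, $\langle E|t\rangle=(2\pi)^{-1/2}e^{itE}$, are called time states. For a density operator $\hat\rho$ of the weight let $f(E)=\langle E|\hat\rho|E\rangle$ and $g(t)=\langle t|\hat\rho|t\rangle$ be the probability densities (defined almost everywhere) of energy and of time states, and let $\sigma_E\in[0,\infty]$ be the standard deviation of the distribution with density $f$ (equal to $\infty$ if the second moment is infinite). A *work extraction protocol* is a unitary $\hat U$ on the composite Hilbert space with $[\hat U,\hat H_S+\hat H_W]=0$ and $[\hat U,\hat\Delta_W]=0$, in the sense that $\hat U$ commutes with the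 unitary groups generated by $\hat H_S+\hat H_W$ and by $\hat\Delta_W$. It acts on an initial product state $\hat\rho_S\otimes\hat\rho_W$ of density operators, so that the final state of the weight is $\hat\rho_W'=\mathrm{Tr}_S[\hat U(\hat\rho_S\otimes\hat\rho_W)\hat U^\dagger]$. Let $g$ and $\sigma_E^{(i)}$ be the time-state density and the energy standard deviation of $\hat\rho_W$, let $g'$ and $\sigma_E^{(f)}$ be those of $\hat\rho_W'$, and let $$\gamma(\omega)=\int_{\mathbb R} g(t)\,e^{i\omega t}\,dt ,\qquad \omega\in\mathbb R,$$ be the characteristic function of $g$. **Theorem.** For all density operators $\hat\rho_S$, $\hat\rho_W$ and every work extraction protocol $\hat U$: 1. $\gamma$ is the dumping function of the ergotropy decoherence: with $\hat S=e^{-i\hat H_S\otimes\hat\Delta_W}$, the control-marginal state $\hat\sigma_S=\mathrm{Tr}_W[\hat S(\hat\rho_S\otimes\hat\rho_W)\hat S^\dagger]$ satisfies $\langle\epsilon_i|\hat\sigma_S|\epsilon_j\rangle=\gamma(\epsilon_j-\epsilon_i)\,\langle\epsilon_i|\hat\rho_S|\epsilon_j\rangle$ for all $i,j$. 2. The time-state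 distribution is invariant under the protocol: $g'(t)=g(t)$ for almost every $t$. 3. The initial and the final energy standard deviations of the weight satisfy $$\sigma_E^{(i)}\ \ge\ \frac1\pi\,\sup_{\omega>0}\ \omega\,|\gamma(\omega)|\qquad\text{and}\qquad \sigma_E^{(f)}\ \ge\ \frac1\pi\,\sup_{\omega>0}\ \omega\,|\gamma(\omega)| ,$$ where the supremum is taken in $[0,\infty]$. -/

import Mathlib

open MeasureTheory ProbabilityTheory
open scoped ENNReal InnerProductSpace FourierTransform ComplexOrder

noncomputable section

namespace QuantumWeight

/-! ### Traces and density operators on a Hilbert space -/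

section Trace

variable (H : Type*) [NormedAddCommGroup H] [InnerProductSpace ℂ H] [CompleteSpace H]

/-- The index set of a fixed orthonormal basis of `H`. -/
def BasisIndex : Set H := (exists_hilbertBasis ℂ H).choose

/-- A fixed orthonormal (Hilbert) basis of `H`, used to evaluate traces. -/
def stdBasis : HilbertBasis (BasisIndex H) ℂ H :=
  (exists_hilbertBasis ℂ H).choose_spec.choose

variable {H}

/-- The trace `∑ₖ ⟨bₖ, A bₖ⟩`. For a trace-class `A` it does not depend on the basis. -/
def tr (A : H →L[ℂ] H) : ℂ := ∑' k, ⟪stdBasis H k, A (stdBasis H k)⟫_ℂ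

/-- A density operator: a positive operator which is trace class with trace one. -/
def IsDensityOperator (ρ : H →L[ℂ] H) : Prop :=
  ρ.IsPositive ∧ HasSum (fun k => ⟪stdBasis H k, ρ (stdBasis H k)⟫_ℂ) 1

/-- The positive square root `√ρ` of a positive operator. -/
def opSqrt (ρ : H →L[ℂ] H) : H →L[ℂ] H := CFC.sqrt ρ

end Trace

/-! ### The weight -/

/-- The Hilbert space `L²(ℝ)` of the weight in the energy representation: `ψ(E) = ⟨E|ψ⟩`, and the
weight Hamiltonian `H_W` is the multiplication by `E`. -/
abbrev Weight : Type := Lp ℂ 2 (volume : Measure ℝ)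

/-- The displacement operator `Γ_a = exp(-i a Δ_W)`, `(Γ_a ψ)(E) = ψ(E - a)`. Its generator, the time
operator, is `Δ_W = -i d/dE`, which satisfies `[H_W, Δ_W] = i`. -/
def displacement (a : ℝ) : Weight →L[ℂ] Weight :=
  (Lp.compMeasurePreservingₗᵢ ℂ (fun E : ℝ => E - a)
    (measurePreserving_sub_right volume a)).toContinuousLinearMap

lemma memLp_phase (s : ℝ) :
    MemLp (fun E : ℝ => Complex.exp (-(s * E : ℝ) * Complex.I)) ∞ volume := by
  refine memLp_top_of_bound (by fun_prop) 1 (Filter.Eventually.of_forall fun E => ?_)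
  have := Complex.norm_exp_ofReal_mul_I (-(s * E))
  push_cast at this ⊢
  exact this.le

/-- The free evolution `exp(-i s H_W)` of the weight, `ψ(E) ↦ exp(-i s E) ψ(E)`. -/
def weightEvolution (s : ℝ) : Weight →L[ℂ] Weight :=
  (ContinuousLinearMap.mul ℂ ℂ).holderL volume ∞ 2 2 ((memLp_phase s).toLp _)

/-- The energy density `f(E) = ⟨E|ρ|E⟩`, evaluated as `∑ₖ |⟨E|√ρ|bₖ⟩|²`; that is, the density of
the measure `B ↦ Tr[√ρ 1_B(H_W) √ρ] = Tr[ρ 1_B(H_W)]`. -/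
def energyDensity (ρ : Weight →L[ℂ] Weight) (E : ℝ) : ℝ≥0∞ :=
  ∑' k, ‖(opSqrt ρ (stdBasis Weight k) : Weight) E‖ₑ ^ 2

/-- The amplitude of `ψ` at the time state `|t⟩` with `⟨E|t⟩ = exp(i t E) / √(2π)`, namely
`⟨t|ψ⟩ = (2π)^(-1/2) ∫ exp(-i t E) ψ(E) dE`, in terms of the `L²` Fourier transform, whose
kernel is `exp(-2π i x E)`. -/
def timeAmplitude (ψ : Weight) (t : ℝ) : ℂ :=
  ((√(2 * Real.pi))⁻¹ : ℝ) * (𝓕 ψ : Weight) (t / (2 * Real.pi))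

/-- The time-state density `g(t) = ⟨t|ρ|t⟩`, evaluated as `∑ₖ |⟨t|√ρ|bₖ⟩|²`. -/
def timeDensity (ρ : Weight →L[ℂ] Weight) (t : ℝ) : ℝ≥0∞ :=
  ∑' k, ‖timeAmplitude (opSqrt ρ (stdBasis Weight k)) t‖ₑ ^ 2

/-- The standard deviation `σ_E` of the energy, with value `∞` if the energy distribution has no
finite second moment. -/
def energyStd (ρ : Weight →L[ℂ] Weight) : ℝ≥0∞ :=
  evariance (fun E : ℝ => E) (volume.withDensity (energyDensity ρ)) ^ (1 / 2 : ℝ)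

/-- The characteristic function `γ(ω) = ∫ g(t) exp(i ω t) dt` of the time-state distribution. -/
def dumping (ρ : Weight →L[ℂ] Weight) (ω : ℝ) : ℂ :=
  charFun (volume.withDensity (timeDensity ρ)) ω

/-! ### The composite of the system and the weight -/

variable {ι : Type*} [Fintype ι]

/-- The composite Hilbert space `ℂ^ι ⊗ L²(ℝ)`, as families `(ψᵢ)` standing for
`∑ᵢ |εᵢ⟩ ⊗ ψᵢ`, where `|εᵢ⟩` is the energy eigenbasis of the system. -/
abbrev Composite (ι : Type*) [Fintype ι] : Type _ := PiLp 2 (fun _ : ι => Weight)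

/-- The map `⟨εᵢ| ⊗ 1` from the composite space to the weight. -/
def comp (i : ι) : Composite ι →L[ℂ] Weight := PiLp.proj 2 (fun _ : ι => Weight) i

/-- The map `|εᵢ⟩ ⊗ 1` from the weight to the composite space. -/
def incl (i : ι) : Weight →L[ℂ] Composite ι := ContinuousLinearMap.adjoint (comp i)

/-- The operator `A ⊗ B`, where `A` is given by its matrix in the energy eigenbasis. -/
def tensor (A : Matrix ι ι ℂ) (B : Weight →L[ℂ] Weight) : Composite ι →L[ℂ] Composite ι :=
  ∑ i, ∑ j, A i j • (incl i ∘L B ∘L comp j)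

/-- The block-diagonal operator `∑ⱼ |εⱼ⟩⟨εⱼ| ⊗ B j`. -/
def blockDiag (B : ι → Weight →L[ℂ] Weight) : Composite ι →L[ℂ] Composite ι :=
  ∑ j, incl j ∘L B j ∘L comp j

/-- The partial trace over the system. -/
def trS (X : Composite ι →L[ℂ] Composite ι) : Weight →L[ℂ] Weight :=
  ∑ i, comp i ∘L X ∘L incl i

/-- The partial trace over the weight, as a matrix in the energy eigenbasis. -/
def trW (X : Composite ι →L[ℂ] Composite ι) : Matrix ι ι ℂ :=
  Matrix.of fun i j => tr (comp i ∘L X ∘L incl j)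

/-- The free evolution `exp(-i s (H_S + H_W))`, where `H_S = ∑ⱼ εⱼ |εⱼ⟩⟨εⱼ|`. -/
def freeEvolution (ε : ι → ℝ) (s : ℝ) : Composite ι →L[ℂ] Composite ι :=
  blockDiag fun j => Complex.exp (-(s * ε j : ℝ) * Complex.I) • weightEvolution s

/-- The operator `S = exp(-i H_S ⊗ Δ_W) = ∑ⱼ |εⱼ⟩⟨εⱼ| ⊗ exp(-i εⱼ Δ_W)`. -/
def shiftS (ε : ι → ℝ) : Composite ι →L[ℂ] Composite ι :=
  blockDiag fun j => displacement (ε j)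

/-- A work extraction protocol: a unitary operator with `[U, H_S + H_W] = 0` and `[U, Δ_W] = 0`.
Commuting with an unbounded self-adjoint operator means commuting with the unitary group that it
generates. -/
structure IsProtocol (ε : ι → ℝ) (U : Composite ι →L[ℂ] Composite ι) : Prop where
  unitary : U ∈ unitary (Composite ι →L[ℂ] Composite ι)
  energy_conserving : ∀ s : ℝ, Commute U (freeEvolution ε s)
  translation_invariant : ∀ a : ℝ, Commute U (blockDiag fun _ => displacement a)

/-- A density matrix of the system. -/
def IsDensityMatrix (ρS : Matrix ι ι ℂ) : Prop := ρS.PosSemidef ∧ ρS.trace = 1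

/-- The final state `Tr_S[U (ρ_S ⊗ ρ_W) U†]` of the weight. -/
def finalWeight (U : Composite ι →L[ℂ] Composite ι) (ρS : Matrix ι ι ℂ)
    (ρW : Weight →L[ℂ] Weight) : Weight →L[ℂ] Weight :=
  trS (U ∘L tensor ρS ρW ∘L ContinuousLinearMap.adjoint U)

/-- The control-marginal state `σ_S = Tr_W[S (ρ_S ⊗ ρ_W) S†]`. -/
def controlMarginal (ε : ι → ℝ) (ρS : Matrix ι ι ℂ) (ρW : Weight →L[ℂ] Weight) :
    Matrix ι ι ℂ :=
  trW (shiftS ε ∘L tensor ρS ρW ∘L ContinuousLinearMap.adjoint (shiftS ε))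

end QuantumWeight

end

noncomputable section

namespace QuantumWeight

/-! ### Hilbert–Schmidt operators -/

section HilbertSchmidt

variable {H K L : Type*} [NormedAddCommGroup H] [InnerProductSpace ℂ H] [CompleteSpace H]
  [NormedAddCommGroup K] [InnerProductSpace ℂ K]
  [NormedAddCommGroup L] [InnerProductSpace ℂ L]

open ContinuousLinearMap (adjoint adjoint_inner_left adjoint_inner_right)

/-! Everything rests on the identity γ(ω) = Tr[Γ₋ω ρ], with Γ the displacement group: the Fourier
transform turns Γ₋ω into multiplication by exp(iωt) (`IsDensityOperator.dumping_eq_tsum`,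
`IsDensityOperator.tsum_inner_opSqrt`).

The (i, j) block of S(ρ_S ⊗ ρ_W)S† is a multiple of Γ_{εᵢ} ρ_W Γ_{εⱼ}†, whose trace is Tr[Γ_{εᵢ-εⱼ}
ρ_W] by cyclicity; this gives the damping of coherences. A protocol commutes with every 1 ⊗ Γₐ, so
it preserves Tr[Γₐ ρ] (`hasSum_inner_finalWeight`), hence γ, hence the time-state distribution.

For the uncertainty bound, Cauchy–Schwarz gives |γ(ω)| ≤ ∫ √(f(x) f(x+ω)) dx. Inserting ω ≤ |x+ω-m|
+ |x-m| and applying Cauchy–Schwarz to each term yields ω|γ(ω)| ≤ 2σ. As π ≥ 2, this implies the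
constant 1/π; since γ is invariant, the same argument applies to the final state.

Traces are series over a fixed basis, so cyclicity is proved for Hilbert–Schmidt factors: √ρ for the
weight, and Q with QQ† = ρ_S ⊗ ρ_W on the composite. -/

/-- The index set of the chosen orthonormal basis of a separable Hilbert space is countable. -/
instance countable_basisIndex [SecondCountableTopology H] : Countable (BasisIndex H) := by
  have ho := (stdBasis H).orthonormal
  -- Distinct basis vectors are at distance √2, so balls of radius 1/2 around them are disjoint.
  -- Countability later permits exchanging sums over the basis with integrals.
  refine Pairwise.countable_of_isOpen_disjoint (s := fun k => Metric.ball (stdBasis H k) (1 / 2))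
    (fun i j hij => Metric.ball_disjoint_ball ?_) (fun _ => Metric.isOpen_ball)
    fun _ => Metric.nonempty_ball.2 (by norm_num)
  have h : ‖stdBasis H i - stdBasis H j‖ ^ 2 = 2 := by
    rw [@norm_sub_sq ℂ, ho.1, ho.1, ho.2 hij]
    norm_num
  rw [dist_eq_norm]
  nlinarith [norm_nonneg (stdBasis H i - stdBasis H j)]

/-- Parseval's identity for the chosen orthonormal basis. -/
lemma hasSum_sq_norm_inner_stdBasis (v : H) :
    HasSum (fun k => ‖⟪stdBasis H k, v⟫_ℂ‖ ^ 2) (‖v‖ ^ 2) := by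
  have h := (stdBasis H).hasSum_inner_mul_inner v v
  have h2 : HasSum (fun k => ((‖⟪stdBasis H k, v⟫_ℂ‖ ^ 2 : ℝ) : ℂ)) ((‖v‖ ^ 2 : ℝ) : ℂ) := by
    convert! h using 2 with k
    · rw [← inner_conj_symm v, RCLike.conj_mul]; simp
    · rw [inner_self_eq_norm_sq_to_K]; simp
  exact_mod_cast h2

/-- The Hilbert–Schmidt property. -/
def IsHilbertSchmidt (X : H →L[ℂ] K) : Prop := Summable fun k => ‖X (stdBasis H k)‖ ^ 2

lemma summable_prod_sq_norm_inner [CompleteSpace K] {X : H →L[ℂ] K} (hX : IsHilbertSchmidt X) :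
    Summable fun p : BasisIndex H × BasisIndex K =>
      ‖⟪stdBasis K p.2, X (stdBasis H p.1)⟫_ℂ‖ ^ 2 := by
  rw [summable_prod_of_nonneg fun _ => sq_nonneg _]
  refine ⟨fun k => ?_, ?_⟩
  · exact (hasSum_sq_norm_inner_stdBasis (X (stdBasis H k))).summable
  · simp_rw [fun k => (hasSum_sq_norm_inner_stdBasis (X (stdBasis H k))).tsum_eq]
    exact hX

/-- The squared matrix entries of X and X† form the same double series, summed in the two orders. -/
lemma isHilbertSchmidt_adjoint [CompleteSpace K] {X : H →L[ℂ] K} (hX : IsHilbertSchmidt X) :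
    IsHilbertSchmidt (adjoint X) := by
  have h := ((summable_prod_sq_norm_inner hX).prod_symm).prod
  refine h.congr fun l => ?_
  rw [← (hasSum_sq_norm_inner_stdBasis _).tsum_eq]
  refine tsum_congr fun k => ?_
  rw [adjoint_inner_right, ← inner_conj_symm, RCLike.norm_conj]
  rfl

lemma IsHilbertSchmidt.comp_left {X : H →L[ℂ] K} (hX : IsHilbertSchmidt X) (A : K →L[ℂ] L) :
    IsHilbertSchmidt (A ∘L X) := by
  refine Summable.of_nonneg_of_le (fun _ => by positivity) (fun k => ?_) (hX.mul_left (‖A‖ ^ 2))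
  rw [← mul_pow]
  gcongr
  exact A.le_opNorm _

lemma IsHilbertSchmidt.summable_inner {X Y : H →L[ℂ] K} (hX : IsHilbertSchmidt X)
    (hY : IsHilbertSchmidt Y) :
    Summable fun k => ⟪X (stdBasis H k), Y (stdBasis H k)⟫_ℂ := by
  refine Summable.of_norm_bounded (hX.add hY) fun k => ?_
  refine (norm_inner_le_norm _ _).trans ?_
  nlinarith [sq_nonneg (‖X (stdBasis H k)‖ - ‖Y (stdBasis H k)‖),
    sq_nonneg ‖X (stdBasis H k)‖, sq_nonneg ‖Y (stdBasis H k)‖]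

/-- Cyclicity of the trace: `Tr[X† Y] = Tr[Y X†]` for Hilbert–Schmidt operators. -/
lemma tsum_inner_eq_tsum_inner_adjoint [CompleteSpace K] {X Y : H →L[ℂ] K} (hX : IsHilbertSchmidt X)
    (hY : IsHilbertSchmidt Y) :
    ∑' k, ⟪X (stdBasis H k), Y (stdBasis H k)⟫_ℂ =
      ∑' l, ⟪adjoint Y (stdBasis K l), adjoint X (stdBasis K l)⟫_ℂ := by
  -- Absolute summability, from |xy| ≤ |x|² + |y|², justifies interchanging the two sums.
  have hs : Summable fun p : BasisIndex H × BasisIndex K =>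
      ⟪X (stdBasis H p.1), stdBasis K p.2⟫_ℂ * ⟪stdBasis K p.2, Y (stdBasis H p.1)⟫_ℂ := by
    refine Summable.of_norm_bounded
      ((summable_prod_sq_norm_inner hX).add (summable_prod_sq_norm_inner hY)) fun p => ?_
    rw [norm_mul, norm_inner_symm]
    nlinarith [sq_nonneg (‖⟪stdBasis K p.2, X (stdBasis H p.1)⟫_ℂ‖ -
      ‖⟪stdBasis K p.2, Y (stdBasis H p.1)⟫_ℂ‖),
      sq_nonneg ‖⟪stdBasis K p.2, X (stdBasis H p.1)⟫_ℂ‖,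
      sq_nonneg ‖⟪stdBasis K p.2, Y (stdBasis H p.1)⟫_ℂ‖]
  calc _ = ∑' k, ∑' l, ⟪X (stdBasis H k), stdBasis K l⟫_ℂ * ⟪stdBasis K l, Y (stdBasis H k)⟫_ℂ :=
        tsum_congr fun k => ((stdBasis K).tsum_inner_mul_inner _ _).symm
    _ = ∑' l, ∑' k, ⟪X (stdBasis H k), stdBasis K l⟫_ℂ * ⟪stdBasis K l, Y (stdBasis H k)⟫_ℂ :=
        (hs.tsum_comm).symm
    _ = _ := tsum_congr fun l => by
        rw [← (stdBasis H).tsum_inner_mul_inner]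
        refine tsum_congr fun k => ?_
        rw [adjoint_inner_left, adjoint_inner_right, mul_comm]

/-! ### Square roots of density operators -/

lemma adjoint_opSqrt (ρ : H →L[ℂ] H) : adjoint (opSqrt ρ) = opSqrt ρ :=
  (IsSelfAdjoint.of_nonneg (CFC.sqrt_nonneg ρ)).adjoint_eq

lemma opSqrt_apply_opSqrt {ρ : H →L[ℂ] H} (hρ : ρ.IsPositive) (v : H) :
    opSqrt ρ (opSqrt ρ v) = ρ v :=
  congrArg (fun A : H →L[ℂ] H => A v)
    (CFC.sqrt_mul_sqrt_self ρ ((ContinuousLinearMap.nonneg_iff_isPositive ρ).2 hρ))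

lemma IsDensityOperator.hasSum_sq_norm_opSqrt {ρ : H →L[ℂ] H} (hρ : IsDensityOperator ρ) :
    HasSum (fun k => ‖opSqrt ρ (stdBasis H k)‖ ^ 2) 1 := by
  have h2 : HasSum (fun k => ((‖opSqrt ρ (stdBasis H k)‖ ^ 2 : ℝ) : ℂ)) ((1 : ℝ) : ℂ) := by
    convert! hρ.2 using 2 with k
    · rw [← opSqrt_apply_opSqrt hρ.1]
      nth_rw 2 [← adjoint_opSqrt]
      rw [adjoint_inner_right, inner_self_eq_norm_sq_to_K]
      simp
  exact_mod_cast h2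

lemma IsDensityOperator.isHilbertSchmidt {ρ : H →L[ℂ] H} (hρ : IsDensityOperator ρ) :
    IsHilbertSchmidt (opSqrt ρ) := hρ.hasSum_sq_norm_opSqrt.summable

/-- `Tr[√ρ B† A √ρ] = Tr[A ρ B†]`. -/
lemma IsDensityOperator.tsum_inner_opSqrt_opSqrt {ρ : H →L[ℂ] H} (hρ : IsDensityOperator ρ)
    (A B : H →L[ℂ] H) :
    ∑' k, ⟪B (opSqrt ρ (stdBasis H k)), A (opSqrt ρ (stdBasis H k))⟫_ℂ =
      tr (A ∘L ρ ∘L adjoint B) := by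
  have h := tsum_inner_eq_tsum_inner_adjoint (hρ.isHilbertSchmidt.comp_left B)
    (hρ.isHilbertSchmidt.comp_left A)
  refine h.trans (tsum_congr fun l => ?_)
  rw [adjoint_inner_left, ContinuousLinearMap.adjoint_comp, adjoint_opSqrt]
  simp [opSqrt_apply_opSqrt hρ.1]

/-- `Tr[√ρ A √ρ] = Tr[A ρ]`. -/
lemma IsDensityOperator.tsum_inner_opSqrt {ρ : H →L[ℂ] H} (hρ : IsDensityOperator ρ)
    (A : H →L[ℂ] H) :
    ∑' k, ⟪opSqrt ρ (stdBasis H k), A (opSqrt ρ (stdBasis H k))⟫_ℂ = tr (A ∘L ρ) := by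
  have h : adjoint (.id ℂ H) = .id ℂ H := star_one (R := H →L[ℂ] H)
  simpa [h] using hρ.tsum_inner_opSqrt_opSqrt A (.id ℂ H)

end HilbertSchmidt

/-! ### The time-state distribution -/

instance : SecondCountableTopology Weight :=
  haveI : Fact ((2 : ℝ≥0∞) ≠ ∞) := ⟨ENNReal.ofNat_ne_top⟩
  inferInstance

lemma coeFn_displacement (a : ℝ) (ψ : Weight) :
    displacement a ψ =ᵐ[volume] fun E => ψ (E - a) :=
  Lp.coeFn_compMeasurePreserving ψ (measurePreserving_sub_right volume a)

lemma coeFn_weightEvolution (s : ℝ) (ψ : Weight) :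
    weightEvolution s ψ =ᵐ[volume] fun E => Complex.exp (-(s * E : ℝ) * Complex.I) * ψ E := by
  have h1 := (ContinuousLinearMap.mul ℂ ℂ).coeFn_holder (r := 2) ((memLp_phase s).toLp _) ψ
  filter_upwards [h1, (memLp_phase s).coeFn_toLp] with E h1 h2
  rw [h2] at h1
  exact h1

/-- Both sides are continuous in ψ, so Schwartz functions suffice; there the Fourier integral is
explicit and a translation of the variable produces the phase. -/
lemma fourier_displacement (a : ℝ) (ψ : Weight) :
    (𝓕 (displacement a ψ) : Weight) = weightEvolution (2 * Real.pi * a) (𝓕 ψ) := by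
  refine DenseRange.induction_on (p := fun ψ : Weight =>
    (𝓕 (displacement a ψ) : Weight) = weightEvolution (2 * Real.pi * a) (𝓕 ψ))
    (SchwartzMap.denseRange_toLpCLM (E := ℝ) (F := ℂ) (μ := volume) (p := 2)
      ENNReal.ofNat_ne_top) ψ ?_ ?_
  · have hF : Continuous fun φ : Weight => (𝓕 φ : Weight) :=
      (Lp.fourierTransformₗᵢ ℝ ℂ).continuous
    exact isClosed_eq (hF.comp (displacement a).continuous)
      ((weightEvolution (2 * Real.pi * a)).continuous.comp hF)
  · intro f
    change (𝓕 (displacement a (f.toLp 2)) : Weight) = weightEvolution _ (𝓕 (f.toLp 2))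
    have hd : displacement a (f.toLp 2) = (f.compSubConstCLM ℂ a).toLp 2 := by
      refine Lp.ext ?_
      have hf := (measurePreserving_sub_right volume a).quasiMeasurePreserving.ae_eq_comp
        (f.coeFn_toLp 2 volume)
      filter_upwards [coeFn_displacement a (f.toLp 2), hf,
        (f.compSubConstCLM ℂ a).coeFn_toLp 2 volume] with E h1 h2 h3
      rw [h1, h3]
      exact h2
    rw [hd, SchwartzMap.toLp_fourier_eq, SchwartzMap.toLp_fourier_eq]
    refine Lp.ext ?_
    filter_upwards [coeFn_weightEvolution (2 * Real.pi * a) ((𝓕 f).toLp 2),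
      (𝓕 f).coeFn_toLp 2 volume, (𝓕 (f.compSubConstCLM ℂ a)).coeFn_toLp 2 volume] with x h1 h2 h3
    rw [h1, h2, h3, SchwartzMap.fourier_coe, SchwartzMap.fourier_coe, Real.fourier_eq,
      Real.fourier_eq, ← integral_const_mul,
      ← integral_sub_right_eq_self (fun v => Complex.exp _ * _) a]
    refine integral_congr_ae (.of_forall fun v => ?_)
    simp only [SchwartzMap.compSubConstCLM_apply, Circle.smul_def, Real.fourierChar_apply,
      smul_eq_mul, ← mul_assoc, ← Complex.exp_add]
    congr 2
    simp
    ring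

lemma measurable_timeAmplitude (ψ : Weight) : Measurable (timeAmplitude ψ) := by
  have h := (Lp.stronglyMeasurable (𝓕 ψ : Weight)).measurable
  unfold timeAmplitude
  fun_prop

lemma integrable_sq_norm_coe (ψ : Weight) : Integrable (fun x => ‖ψ x‖ ^ 2) := by
  have := (Lp.memLp ψ).integrable_norm_pow (by norm_num)
  simpa using this

lemma sq_norm_timeAmplitude (ψ : Weight) (t : ℝ) : ‖timeAmplitude ψ t‖ ^ 2 =
    (2 * Real.pi)⁻¹ * ‖(𝓕 ψ : Weight) (t / (2 * Real.pi))‖ ^ 2 := by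
  have h : (0 : ℝ) ≤ 2 * Real.pi := by positivity
  rw [timeAmplitude, norm_mul, mul_pow, Complex.norm_real, Real.norm_eq_abs, sq_abs, inv_pow,
    Real.sq_sqrt h]

lemma lintegral_sq_enorm_timeAmplitude (ψ : Weight) :
    ∫⁻ t, ‖timeAmplitude ψ t‖ₑ ^ 2 = ENNReal.ofReal (‖ψ‖ ^ 2) := by
  have h2pi : (2 * Real.pi) ≠ 0 := by positivity
  have hint : Integrable (fun t => ‖timeAmplitude ψ t‖ ^ 2) := by
    simp_rw [sq_norm_timeAmplitude]
    exact ((integrable_sq_norm_coe (𝓕 ψ)).comp_div h2pi).const_mul _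
  have hval : ∫ t, ‖timeAmplitude ψ t‖ ^ 2 = ‖ψ‖ ^ 2 := by
    simp_rw [sq_norm_timeAmplitude]
    rw [integral_const_mul, Measure.integral_comp_div (fun x => ‖(𝓕 ψ : Weight) x‖ ^ 2),
      ← Lp.norm_fourier_eq ψ, @norm_sq_eq_re_inner ℂ, L2.inner_def,
      abs_of_pos (by positivity), smul_eq_mul, inv_mul_cancel_left₀ h2pi]
    rw [← integral_re (L2.integrable_inner _ _)]
    simp [← Complex.ofReal_pow]
  rw [← hval, ofReal_integral_eq_lintegral_ofReal hint (.of_forall fun _ => sq_nonneg _)]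
  refine lintegral_congr fun t => ?_
  rw [ENNReal.ofReal_pow (norm_nonneg _), ofReal_norm]

/-- Plancherel moves the inner product to Fourier space, where the displacement is a phase; the
substitution t = 2πx matches the two normalizations. -/
lemma charFun_sq_enorm_timeAmplitude (ψ : Weight) (ω : ℝ) :
    charFun (volume.withDensity fun t => ‖timeAmplitude ψ t‖ₑ ^ 2) ω =
      ⟪ψ, displacement (-ω) ψ⟫_ℂ := by
  have h2pi : (2 * Real.pi) ≠ 0 := by positivity
  have hm := measurable_timeAmplitude ψ
  rw [← Lp.inner_fourier_eq, fourier_displacement, L2.inner_def, charFun_apply_real,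
    integral_withDensity_eq_integral_toReal_smul (by fun_prop)
      (.of_forall fun t => ENNReal.pow_lt_top enorm_lt_top)]
  set G : ℝ → ℂ := fun x => ((‖(𝓕 ψ : Weight) x‖ ^ 2 : ℝ) : ℂ) *
    Complex.exp (-((2 * Real.pi * -ω) * x : ℝ) * Complex.I) with hG
  have h1 : ∀ t : ℝ, (‖timeAmplitude ψ t‖ₑ ^ 2).toReal • Complex.exp (ω * t * Complex.I) =
      ((2 * Real.pi)⁻¹ : ℝ) • G (t / (2 * Real.pi)) := by
    intro t
    rw [hG, ENNReal.toReal_pow, toReal_enorm, sq_norm_timeAmplitude, Complex.real_smul,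
      Complex.real_smul, Complex.ofReal_mul, mul_assoc]
    congr 4
    push_cast
    field_simp
  rw [integral_congr_ae (.of_forall h1)]
  rw [integral_smul, Measure.integral_comp_div G, abs_of_pos (by positivity), smul_smul,
    inv_mul_cancel₀ h2pi, one_smul]
  refine integral_congr_ae ?_
  filter_upwards [coeFn_weightEvolution (2 * Real.pi * -ω) (𝓕 ψ)] with x hx
  rw [hx, RCLike.inner_apply, mul_assoc, RCLike.mul_conj, mul_comm, hG]
  simp

lemma withDensity_timeDensity (ρ : Weight →L[ℂ] Weight) :
    volume.withDensity (timeDensity ρ) = Measure.sum fun k =>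
      volume.withDensity fun t => ‖timeAmplitude (opSqrt ρ (stdBasis Weight k)) t‖ₑ ^ 2 := by
  rw [← withDensity_tsum fun _ => (measurable_timeAmplitude _).enorm.pow_const 2]
  congr 1
  ext t
  rw [timeDensity, tsum_apply (Pi.summable.2 fun _ => ENNReal.summable)]

lemma measurable_timeDensity (ρ : Weight →L[ℂ] Weight) : Measurable (timeDensity ρ) :=
  Measurable.tsum fun _ => (measurable_timeAmplitude _).enorm.pow_const 2

lemma IsDensityOperator.lintegral_timeDensity {ρ : Weight →L[ℂ] Weight}
    (hρ : IsDensityOperator ρ) : ∫⁻ t, timeDensity ρ t = 1 := by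
  unfold timeDensity
  rw [lintegral_tsum fun k => ((measurable_timeAmplitude _).enorm.pow_const 2).aemeasurable]
  simp_rw [lintegral_sq_enorm_timeAmplitude]
  rw [← ENNReal.ofReal_tsum_of_nonneg (fun _ => sq_nonneg _) hρ.isHilbertSchmidt,
    hρ.hasSum_sq_norm_opSqrt.tsum_eq, ENNReal.ofReal_one]

lemma IsDensityOperator.isProbabilityMeasure_timeDensity {ρ : Weight →L[ℂ] Weight}
    (hρ : IsDensityOperator ρ) : IsProbabilityMeasure (volume.withDensity (timeDensity ρ)) :=
  ⟨by rw [withDensity_apply _ .univ, Measure.restrict_univ, hρ.lintegral_timeDensity]⟩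

lemma IsDensityOperator.dumping_eq_tsum {ρ : Weight →L[ℂ] Weight} (hρ : IsDensityOperator ρ)
    (ω : ℝ) : dumping ρ ω = ∑' k, ⟪opSqrt ρ (stdBasis Weight k),
      displacement (-ω) (opSqrt ρ (stdBasis Weight k))⟫_ℂ := by
  have := hρ.isProbabilityMeasure_timeDensity
  simp_rw [← charFun_sq_enorm_timeAmplitude]
  have hint : Integrable (fun t : ℝ => Complex.exp (ω * t * Complex.I))
      (volume.withDensity (timeDensity ρ)) := by
    refine (integrable_const (1 : ℝ)).mono' (by fun_prop) (.of_forall fun t => ?_)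
    have := Complex.norm_exp_ofReal_mul_I (ω * t)
    push_cast at this
    exact this.le
  rw [withDensity_timeDensity] at hint
  simp_rw [dumping, charFun_apply_real, withDensity_timeDensity]
  exact (hasSum_integral_measure hint).tsum_eq.symm

/-! ### The uncertainty relation -/

lemma lintegral_sq_enorm_coe (ψ : Weight) :
    ∫⁻ x, ‖ψ x‖ₑ ^ 2 = ENNReal.ofReal (‖ψ‖ ^ 2) := by
  have h : ‖ψ‖ₑ = (∫⁻ x, ‖ψ x‖ₑ ^ (2 : ℝ)) ^ (1 / 2 : ℝ) := by
    rw [Lp.enorm_def, eLpNorm_eq_lintegral_rpow_enorm_toReal (by norm_num) (by norm_num)]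
    simp
  rw [ENNReal.ofReal_pow (norm_nonneg _), ofReal_norm, h, ← ENNReal.rpow_natCast,
    ← ENNReal.rpow_mul]
  simp

lemma measurable_energyDensity (ρ : Weight →L[ℂ] Weight) : Measurable (energyDensity ρ) :=
  Measurable.tsum fun _ => (Lp.stronglyMeasurable _).measurable.enorm.pow_const 2

lemma IsDensityOperator.lintegral_energyDensity {ρ : Weight →L[ℂ] Weight}
    (hρ : IsDensityOperator ρ) : ∫⁻ E, energyDensity ρ E = 1 := by
  unfold energyDensity
  rw [lintegral_tsum fun _ =>
    ((Lp.stronglyMeasurable _).measurable.enorm.pow_const 2).aemeasurable]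
  simp_rw [lintegral_sq_enorm_coe]
  rw [← ENNReal.ofReal_tsum_of_nonneg (fun _ => sq_nonneg _) hρ.isHilbertSchmidt,
    hρ.hasSum_sq_norm_opSqrt.tsum_eq, ENNReal.ofReal_one]

/-- The Cauchy–Schwarz inequality for series of extended nonnegative numbers. -/
lemma tsum_mul_le_sqrt_mul_sqrt {κ : Type*} (f g : κ → ℝ≥0∞) :
    ∑' k, f k * g k ≤ (∑' k, f k ^ 2) ^ (1 / 2 : ℝ) * (∑' k, g k ^ 2) ^ (1 / 2 : ℝ) := by
  -- The series are integrals for counting measure, so Hölder's inequality applies.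
  let _ : MeasurableSpace κ := ⊤
  have h := ENNReal.lintegral_mul_le_Lp_mul_Lq (Measure.count : Measure κ)
    Real.HolderConjugate.two_two (f := f) (g := g) measurable_from_top.aemeasurable
    measurable_from_top.aemeasurable
  simpa [lintegral_count, ENNReal.rpow_two] using h

/-- The Cauchy–Schwarz inequality for extended nonnegative functions. -/
lemma lintegral_mul_le_sqrt_mul_sqrt {f g : ℝ → ℝ≥0∞} (hf : Measurable f) (hg : Measurable g) :
    ∫⁻ x, f x * g x ≤ (∫⁻ x, f x ^ 2) ^ (1 / 2 : ℝ) * (∫⁻ x, g x ^ 2) ^ (1 / 2 : ℝ) := by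
  have h := ENNReal.lintegral_mul_le_Lp_mul_Lq volume
    Real.HolderConjugate.two_two hf.aemeasurable hg.aemeasurable
  simpa [ENNReal.rpow_two] using h

/-- The overlap of a probability density with its translate by `ω` is at most `2 σ / ω`, where `σ`
is the root mean square deviation from any point `m`. -/
lemma ofReal_mul_lintegral_sqrt_mul_sqrt_le {f : ℝ → ℝ≥0∞} (hf : Measurable f)
    (hf1 : ∫⁻ x, f x = 1) (m ω : ℝ) :
    ENNReal.ofReal ω * ∫⁻ x, f x ^ (1 / 2 : ℝ) * f (x + ω) ^ (1 / 2 : ℝ) ≤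
      2 * (∫⁻ x, ‖x - m‖ₑ ^ 2 * f x) ^ (1 / 2 : ℝ) := by
  set s : ℝ → ℝ≥0∞ := fun x => f x ^ (1 / 2 : ℝ) with hs
  have hsm : Measurable s := by fun_prop
  have hsq : ∀ x, s x ^ 2 = f x := fun x => by
    rw [hs, ← ENNReal.rpow_natCast, ← ENNReal.rpow_mul]
    simp
  set σ := (∫⁻ x, ‖x - m‖ₑ ^ 2 * f x) ^ (1 / 2 : ℝ)
  have h1 : ∫⁻ x, (‖x - m‖ₑ * s x) * s (x + ω) ≤ σ := by
    refine (lintegral_mul_le_sqrt_mul_sqrt (by fun_prop) (by fun_prop)).trans ?_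
    simp_rw [mul_pow, hsq, lintegral_add_right_eq_self f ω, hf1, ENNReal.one_rpow, mul_one]
    exact le_rfl
  have h2 : ∫⁻ x, s x * (‖x + ω - m‖ₑ * s (x + ω)) ≤ σ := by
    refine (lintegral_mul_le_sqrt_mul_sqrt (by fun_prop) (by fun_prop)).trans ?_
    simp_rw [mul_pow, hsq, hf1, ENNReal.one_rpow, one_mul]
    rw [lintegral_add_right_eq_self (fun x => ‖x - m‖ₑ ^ 2 * f x) ω]
  calc _ = ∫⁻ x, ENNReal.ofReal ω * (s x * s (x + ω)) :=
        (lintegral_const_mul _ (by fun_prop)).symm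
    _ ≤ ∫⁻ x, ((‖x - m‖ₑ * s x) * s (x + ω) + s x * (‖x + ω - m‖ₑ * s (x + ω))) := by
        refine lintegral_mono fun x => ?_
        have h : ENNReal.ofReal ω ≤ ‖x + ω - m‖ₑ + ‖x - m‖ₑ := by
          calc ENNReal.ofReal ω ≤ ‖ω‖ₑ := Real.ofReal_le_enorm ω
            _ = ‖(x + ω - m) - (x - m)‖ₑ := by ring_nf
            _ ≤ _ := enorm_sub_le
        calc _ ≤ (‖x + ω - m‖ₑ + ‖x - m‖ₑ) * (s x * s (x + ω)) := by gcongr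
          _ = _ := by ring
    _ = _ := lintegral_add_left (by fun_prop) _
    _ ≤ σ + σ := add_le_add h1 h2
    _ = _ := (two_mul σ).symm

lemma enorm_inner_displacement_le (ψ : Weight) (ω : ℝ) :
    ‖⟪ψ, displacement (-ω) ψ⟫_ℂ‖ₑ ≤ ∫⁻ x, ‖ψ x‖ₑ * ‖ψ (x + ω)‖ₑ := by
  rw [L2.inner_def]
  refine (enorm_integral_le_lintegral_enorm _).trans (lintegral_mono_ae ?_)
  filter_upwards [coeFn_displacement (-ω) ψ] with x hx
  rw [hx, sub_neg_eq_add, RCLike.inner_apply, enorm_mul, mul_comm, RCLike.enorm_conj]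

/-- For a mixed state, Cauchy–Schwarz over the index k, pointwise in x, replaces the sum of overlaps
by the overlap of the total densities. -/
lemma IsDensityOperator.enorm_dumping_le {ρ : Weight →L[ℂ] Weight} (hρ : IsDensityOperator ρ)
    (ω : ℝ) : ‖dumping ρ ω‖ₑ ≤
      ∫⁻ x, energyDensity ρ x ^ (1 / 2 : ℝ) * energyDensity ρ (x + ω) ^ (1 / 2 : ℝ) := by
  have hm : ∀ ψ : Weight, Measurable ψ := fun ψ => (Lp.stronglyMeasurable ψ).measurable
  rw [hρ.dumping_eq_tsum]
  calc _ ≤ ∑' k, ‖⟪opSqrt ρ (stdBasis Weight k),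
        displacement (-ω) (opSqrt ρ (stdBasis Weight k))⟫_ℂ‖ₑ := enorm_tsum_le_tsum_enorm
    _ ≤ ∑' k, ∫⁻ x, ‖opSqrt ρ (stdBasis Weight k) x‖ₑ * ‖opSqrt ρ (stdBasis Weight k) (x + ω)‖ₑ :=
        ENNReal.tsum_le_tsum fun k => enorm_inner_displacement_le _ ω
    _ = ∫⁻ x, ∑' k, ‖opSqrt ρ (stdBasis Weight k) x‖ₑ *
          ‖opSqrt ρ (stdBasis Weight k) (x + ω)‖ₑ :=
        (lintegral_tsum fun k => ((hm _).enorm.mul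
          ((hm _).comp (measurable_add_const ω)).enorm).aemeasurable).symm
    _ ≤ _ := lintegral_mono fun x => tsum_mul_le_sqrt_mul_sqrt _ _

lemma IsDensityOperator.ofReal_mul_norm_dumping_le {ρ : Weight →L[ℂ] Weight}
    (hρ : IsDensityOperator ρ) {ω : ℝ} (hω : 0 < ω) :
    ENNReal.ofReal (ω * ‖dumping ρ ω‖) ≤ 2 * energyStd ρ := by
  -- Here m is the Bochner mean, equal to 0 if E is not integrable; this default is harmless because
  -- the overlap bound holds for every m.
  have hσ : energyStd ρ = (∫⁻ x, ‖x - ∫ E, E ∂(volume.withDensity (energyDensity ρ))‖ₑ ^ 2 *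
      energyDensity ρ x) ^ (1 / 2 : ℝ) := by
    rw [energyStd, evariance, lintegral_withDensity_eq_lintegral_mul _ (measurable_energyDensity ρ)
      (by fun_prop)]
    simp only [Pi.mul_apply, mul_comm]
  rw [ENNReal.ofReal_mul hω.le, ofReal_norm, hσ]
  exact (mul_le_mul_right (hρ.enorm_dumping_le ω) _).trans
    (ofReal_mul_lintegral_sqrt_mul_sqrt_le (measurable_energyDensity ρ)
      hρ.lintegral_energyDensity _ ω)

lemma IsDensityOperator.iSup_dumping_le_energyStd {ρ : Weight →L[ℂ] Weight}
    (hρ : IsDensityOperator ρ) :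
    ENNReal.ofReal (1 / Real.pi) *
      (⨆ ω ∈ Set.Ioi (0 : ℝ), ENNReal.ofReal (ω * ‖dumping ρ ω‖)) ≤ energyStd ρ := by
  have hpi : ENNReal.ofReal (1 / Real.pi) * 2 ≤ 1 := by
    rw [← ENNReal.ofReal_ofNat 2, ← ENNReal.ofReal_mul (by positivity)]
    refine ENNReal.ofReal_le_one.2 ?_
    rw [div_mul_eq_mul_div, one_mul, div_le_one Real.pi_pos]
    exact Real.two_le_pi
  calc _ ≤ ENNReal.ofReal (1 / Real.pi) * (2 * energyStd ρ) := by
        gcongr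
        exact iSup₂_le fun ω hω => hρ.ofReal_mul_norm_dumping_le hω
    _ ≤ 1 * energyStd ρ := by rw [← mul_assoc]; gcongr
    _ = _ := one_mul _

/-! ### Operators on the composite space -/

section Composite

open ContinuousLinearMap (adjoint adjoint_inner_left adjoint_inner_right adjoint_comp
  adjoint_adjoint)

variable {ι : Type*} [Fintype ι]

lemma incl_eq_single [DecidableEq ι] (i : ι) (w : Weight) :
    incl i w = WithLp.toLp 2 (Pi.single i w) := by
  refine ext_inner_right ℂ fun v => ?_
  rw [incl, adjoint_inner_left, PiLp.inner_apply, Finset.sum_eq_single i]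
  · simp [comp]
  · intro j _ hj
    simp [hj]
  · simp

lemma comp_incl [DecidableEq ι] (i j : ι) (w : Weight) :
    comp i (incl j w) = if i = j then w else 0 := by
  rw [incl_eq_single]
  simp [comp]

lemma composite_ext {v w : Composite ι} (h : ∀ i, comp i v = comp i w) : v = w :=
  PiLp.ext h

lemma comp_blockDiag (B : ι → Weight →L[ℂ] Weight) (i : ι) :
    comp i ∘L blockDiag B = B i ∘L comp i := by
  classical
  ext1 v
  simp [blockDiag, comp_incl]

lemma comp_tensor_apply (A : Matrix ι ι ℂ) (B : Weight →L[ℂ] Weight) (i : ι) (v : Composite ι) :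
    comp i (tensor A B v) = ∑ j, A i j • B (comp j v) := by
  classical
  simp [tensor, comp_incl]

lemma comp_tensor_incl (A : Matrix ι ι ℂ) (B : Weight →L[ℂ] Weight) (i j : ι) :
    comp i ∘L tensor A B ∘L incl j = A i j • B := by
  classical
  ext1 v
  simp [comp_tensor_apply, comp_incl, apply_ite B]

lemma tensor_comp_tensor (A C : Matrix ι ι ℂ) (B D : Weight →L[ℂ] Weight) :
    tensor A B ∘L tensor C D = tensor (A * C) (B ∘L D) := by
  ext1 v
  refine composite_ext fun i => ?_
  simp only [ContinuousLinearMap.comp_apply, comp_tensor_apply, map_sum, map_smul,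
    Matrix.mul_apply, Finset.smul_sum, Finset.sum_smul, smul_smul]
  exact Finset.sum_comm

lemma adjoint_tensor (A : Matrix ι ι ℂ) (B : Weight →L[ℂ] Weight) :
    adjoint (tensor A B) = tensor A.conjTranspose (adjoint B) := by
  simp only [tensor, map_sum, LinearIsometryEquiv.map_smulₛₗ, adjoint_comp, incl, adjoint_adjoint,
    Matrix.conjTranspose_apply, ContinuousLinearMap.comp_assoc]
  exact Finset.sum_comm

lemma trS_tensor (A : Matrix ι ι ℂ) (B : Weight →L[ℂ] Weight) :
    trS (tensor A B) = A.trace • B := by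
  simp only [trS, comp_tensor_incl, ← Finset.sum_smul]
  rfl

lemma trS_comp_adjoint (Z : Composite ι →L[ℂ] Composite ι) :
    trS (Z ∘L adjoint Z) = ∑ i, (comp i ∘L Z) ∘L adjoint (comp i ∘L Z) := by
  simp only [trS, adjoint_comp, incl, ContinuousLinearMap.comp_assoc]

lemma isPositive_trS_comp_adjoint (Z : Composite ι →L[ℂ] Composite ι) :
    (trS (Z ∘L adjoint Z)).IsPositive := by
  rw [trS_comp_adjoint, ← ContinuousLinearMap.nonneg_iff_isPositive]
  exact Finset.sum_nonneg fun i _ => (ContinuousLinearMap.nonneg_iff_isPositive _).2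
    (ContinuousLinearMap.isPositive_self_comp_adjoint _)

/-- `Tr[A Tr_S[Z Z†]] = Tr[Z† (1 ⊗ A) Z]` for a Hilbert–Schmidt operator `Z`. -/
lemma IsHilbertSchmidt.hasSum_inner_trS {Z : Composite ι →L[ℂ] Composite ι}
    (hZ : IsHilbertSchmidt Z) (A : Weight →L[ℂ] Weight) :
    HasSum (fun k => ⟪stdBasis Weight k, A (trS (Z ∘L adjoint Z) (stdBasis Weight k))⟫_ℂ)
      (∑' c, ⟪Z (stdBasis (Composite ι) c),
        blockDiag (fun _ => A) (Z (stdBasis (Composite ι) c))⟫_ℂ) := by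
  have hX : ∀ i, IsHilbertSchmidt (comp i ∘L Z) := fun i => hZ.comp_left _
  have hY : ∀ i, IsHilbertSchmidt (A ∘L comp i ∘L Z) := fun i => (hX i).comp_left A
  have h1 : ∀ i, HasSum (fun k => ⟪stdBasis Weight k,
      A ((comp i ∘L Z) (adjoint (comp i ∘L Z) (stdBasis Weight k)))⟫_ℂ)
      (∑' c, ⟪(comp i ∘L Z) (stdBasis (Composite ι) c),
        (A ∘L comp i ∘L Z) (stdBasis (Composite ι) c)⟫_ℂ) := by
    intro i
    -- Cyclicity is applied to each block ⟨εᵢ|Z separately; summing over i then gives the partial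
    -- trace.
    rw [tsum_inner_eq_tsum_inner_adjoint (hX i) (hY i)]
    convert! ((isHilbertSchmidt_adjoint (hY i)).summable_inner
      (isHilbertSchmidt_adjoint (hX i))).hasSum using 2 with k
    rw [adjoint_inner_left]
    rfl
  convert! hasSum_sum (s := Finset.univ) fun i _ => h1 i using 2 with k
  · rw [trS_comp_adjoint]
    simp [inner_sum]
  · rw [← Summable.tsum_finsetSum fun i _ => (hX i).summable_inner (hY i)]
    refine tsum_congr fun c => ?_
    rw [PiLp.inner_apply]
    refine Finset.sum_congr rfl fun i _ => ?_
    have := congrArg (fun F : Composite ι →L[ℂ] Weight => F (Z (stdBasis (Composite ι) c)))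
      (comp_blockDiag (fun _ => A) i)
    exact congrArg (⟪comp i (Z (stdBasis (Composite ι) c)), ·⟫_ℂ) this

/-- For X = ⟨εᵢ|Q one has XX† = (ρ_S)ᵢᵢ ρ_W, so ‖X†bₖ‖² is summable because ρ_W is trace class.
Passing to the adjoint and summing over the finitely many i gives the claim for Q. -/
lemma isHilbertSchmidt_of_comp_adjoint_eq_tensor {Q : Composite ι →L[ℂ] Composite ι}
    {ρS : Matrix ι ι ℂ} {ρW : Weight →L[ℂ] Weight} (hρW : IsDensityOperator ρW)
    (hQ : Q ∘L adjoint Q = tensor ρS ρW) : IsHilbertSchmidt Q := by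
  have h : ∀ i, IsHilbertSchmidt (comp i ∘L Q) := by
    intro i
    rw [← adjoint_adjoint (comp i ∘L Q)]
    refine isHilbertSchmidt_adjoint ?_
    refine (hρW.2.summable.mul_left (ρS i i)).norm.congr fun k => ?_
    have h1 : (comp i ∘L Q) ∘L adjoint (comp i ∘L Q) = ρS i i • ρW := by
      rw [← comp_tensor_incl, ← hQ, adjoint_comp]
      rfl
    have h2 := congrArg (fun F : Weight →L[ℂ] Weight => F (stdBasis Weight k)) h1
    simp only [ContinuousLinearMap.comp_apply, smul_apply] at h2
    rw [← inner_smul_right, ← h2]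
    have h3 := adjoint_inner_left (comp i ∘L Q) (adjoint (comp i ∘L Q) (stdBasis Weight k))
      (stdBasis Weight k)
    rw [inner_self_eq_norm_sq_to_K] at h3
    simp only [ContinuousLinearMap.comp_apply] at h3
    rw [← h3]
    simp
  refine (summable_sum (s := Finset.univ) fun i _ => h i).congr fun c => ?_
  rw [PiLp.norm_sq_eq_of_L2]
  rfl

open scoped MatrixOrder in
-- With ρ_S = B†B, take Q = B† ⊗ √ρ_W. Then UQ factors the evolved state, and no square root on the
-- composite is required.
lemma exists_comp_adjoint_eq_tensor {ρS : Matrix ι ι ℂ} (hρS : ρS.PosSemidef)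
    {ρW : Weight →L[ℂ] Weight} (hρW : ρW.IsPositive) :
    ∃ Q : Composite ι →L[ℂ] Composite ι, Q ∘L adjoint Q = tensor ρS ρW := by
  classical
  obtain ⟨B, rfl⟩ := CStarAlgebra.nonneg_iff_eq_star_mul_self.1 hρS.nonneg
  refine ⟨tensor B.conjTranspose (opSqrt ρW), ?_⟩
  rw [Matrix.star_eq_conjTranspose, adjoint_tensor, tensor_comp_tensor, adjoint_opSqrt,
    Matrix.conjTranspose_conjTranspose]
  congr 1
  ext1 v
  exact opSqrt_apply_opSqrt hρW v

/-! ### The final state of the weight -/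

variable {ρS : Matrix ι ι ℂ} {ρW : Weight →L[ℂ] Weight} {U : Composite ι →L[ℂ] Composite ι}

lemma finalWeight_eq_trS {Q : Composite ι →L[ℂ] Composite ι}
    (hQ : Q ∘L adjoint Q = tensor ρS ρW) :
    finalWeight U ρS ρW = trS ((U ∘L Q) ∘L adjoint (U ∘L Q)) := by
  rw [finalWeight, ← hQ, adjoint_comp]
  rfl

/-- A unitary which commutes with `1 ⊗ A` leaves the expectation of `A` in the state of the weight
invariant. -/
lemma hasSum_inner_finalWeight (hρS : IsDensityMatrix ρS) (hρW : IsDensityOperator ρW)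
    (hU : U ∈ unitary (Composite ι →L[ℂ] Composite ι)) {A : Weight →L[ℂ] Weight}
    (hA : Commute U (blockDiag fun _ => A)) :
    HasSum (fun k => ⟪stdBasis Weight k, A (finalWeight U ρS ρW (stdBasis Weight k))⟫_ℂ)
      (tr (A ∘L ρW)) := by
  obtain ⟨Q, hQ⟩ := exists_comp_adjoint_eq_tensor hρS.1 hρW.1
  have hQS := isHilbertSchmidt_of_comp_adjoint_eq_tensor hρW hQ
  have h := (hQS.comp_left U).hasSum_inner_trS A
  have h0 := hQS.hasSum_inner_trS A
  rw [hQ, trS_tensor, hρS.2, one_smul] at h0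
  rw [← finalWeight_eq_trS hQ] at h
  convert! h using 1
  -- The two traces agree term by term: ⟨UQc, (1 ⊗ A)UQc⟩ = ⟨Qc, (1 ⊗ A)Qc⟩ by commutation and U†U =
  -- 1.
  refine h0.tsum_eq.trans (tsum_congr fun c => ?_)
  have hc := congrArg (fun F : Composite ι →L[ℂ] Composite ι => F (Q (stdBasis _ c))) hA.eq
  simp only [mul_apply_eq_comp] at hc
  have hUU := congrArg (fun F : Composite ι →L[ℂ] Composite ι => F (Q (stdBasis _ c)))
    hU.1
  simp only [mul_apply_eq_comp, one_apply_eq_self,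
    ContinuousLinearMap.star_eq_adjoint] at hUU
  rw [ContinuousLinearMap.comp_apply, ← hc, ← adjoint_inner_left U, hUU]

lemma isDensityOperator_finalWeight (hρS : IsDensityMatrix ρS) (hρW : IsDensityOperator ρW)
    (hU : U ∈ unitary (Composite ι →L[ℂ] Composite ι)) :
    IsDensityOperator (finalWeight U ρS ρW) := by
  constructor
  · obtain ⟨Q, hQ⟩ := exists_comp_adjoint_eq_tensor hρS.1 hρW.1
    rw [finalWeight_eq_trS hQ]
    exact isPositive_trS_comp_adjoint _
  -- Normalization is the invariance of the expectation of A = 1.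
  · have h1 : (blockDiag fun _ : ι => ContinuousLinearMap.id ℂ Weight) = 1 := by
      ext1 v
      refine composite_ext fun i => ?_
      exact congrArg (fun F : Composite ι →L[ℂ] Weight => F v) (comp_blockDiag _ i)
    have h := hasSum_inner_finalWeight hρS hρW hU (A := .id ℂ Weight)
      (by rw [h1]; exact Commute.one_right U)
    have h2 : tr (ContinuousLinearMap.id ℂ Weight ∘L ρW) = 1 := hρW.2.tsum_eq
    rw [h2] at h
    exact h

variable {ε : ι → ℝ}

lemma dumping_finalWeight (hρS : IsDensityMatrix ρS) (hρW : IsDensityOperator ρW)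
    (hU : IsProtocol ε U) : dumping (finalWeight U ρS ρW) = dumping ρW := by
  have hF := isDensityOperator_finalWeight hρS hρW hU.unitary
  ext ω
  rw [hF.dumping_eq_tsum, hρW.dumping_eq_tsum, hF.tsum_inner_opSqrt, hρW.tsum_inner_opSqrt]
  exact (hasSum_inner_finalWeight hρS hρW hU.unitary (hU.translation_invariant _)).tsum_eq

/-- A finite measure is determined by its characteristic function, and its density is then
determined almost everywhere. -/
lemma timeDensity_finalWeight (hρS : IsDensityMatrix ρS) (hρW : IsDensityOperator ρW)
    (hU : IsProtocol ε U) : timeDensity (finalWeight U ρS ρW) =ᵐ[volume] timeDensity ρW := by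
  have hF := isDensityOperator_finalWeight hρS hρW hU.unitary
  have := hF.isProbabilityMeasure_timeDensity
  have := hρW.isProbabilityMeasure_timeDensity
  refine (withDensity_eq_iff (measurable_timeDensity _).aemeasurable
    (measurable_timeDensity _).aemeasurable ?_).1
    (Measure.ext_of_charFun (dumping_finalWeight hρS hρW hU))
  rw [hF.lintegral_timeDensity]
  exact ENNReal.one_ne_top

/-! ### The control-marginal state -/

lemma displacement_displacement (a b : ℝ) (ψ : Weight) :
    displacement a (displacement b ψ) = displacement (a + b) ψ := by
  refine Lp.ext ?_
  have h := (measurePreserving_sub_right volume a).quasiMeasurePreserving.ae_eq_comp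
    (coeFn_displacement b ψ)
  filter_upwards [coeFn_displacement a (displacement b ψ), coeFn_displacement (a + b) ψ, h]
    with E h1 h2 h3
  rw [h1, h2, ← sub_sub]
  exact h3

lemma inner_displacement_displacement (a b : ℝ) (ψ : Weight) :
    ⟪displacement b ψ, displacement a ψ⟫_ℂ = ⟪ψ, displacement (a - b) ψ⟫_ℂ := by
  have h := displacement_displacement b (a - b) ψ
  rw [add_sub_cancel] at h
  rw [← h]
  exact LinearIsometry.inner_map_map _ _ _

lemma controlMarginal_apply (ε : ι → ℝ) (ρS : Matrix ι ι ℂ) (hρW : IsDensityOperator ρW)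
    (i j : ι) : controlMarginal ε ρS ρW i j = dumping ρW (ε j - ε i) * ρS i j := by
  have h : comp i ∘L (shiftS ε ∘L tensor ρS ρW ∘L adjoint (shiftS ε)) ∘L incl j =
      ρS i j • (displacement (ε i) ∘L ρW ∘L adjoint (displacement (ε j))) := by
    calc _ = (comp i ∘L shiftS ε) ∘L tensor ρS ρW ∘L adjoint (comp j ∘L shiftS ε) := by
          rw [adjoint_comp]; rfl
      _ = displacement (ε i) ∘L (comp i ∘L tensor ρS ρW ∘L incl j) ∘L
            adjoint (displacement (ε j)) := by
          rw [shiftS, comp_blockDiag, comp_blockDiag, adjoint_comp]; rfl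
      _ = _ := by
          rw [comp_tensor_incl]
          ext1 v
          simp
  -- Writing γ(εⱼ-εᵢ) with Γ_{εᵢ-εⱼ} and splitting this as Γ_{εⱼ}†Γ_{εᵢ} lets cyclicity produce the
  -- trace of the block.
  rw [controlMarginal, trW, Matrix.of_apply, h, hρW.dumping_eq_tsum, neg_sub]
  simp_rw [← inner_displacement_displacement]
  rw [hρW.tsum_inner_opSqrt_opSqrt, tr, tr, ← tsum_mul_right]
  refine tsum_congr fun k => ?_
  rw [smul_apply, inner_smul_right, mul_comm]

end Composite

end QuantumWeight

end

theorem theorem2 {ι : Type*} [Fintype ι] (ε : ι → ℝ)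
    (ρS : Matrix ι ι ℂ) (hρS : QuantumWeight.IsDensityMatrix ρS)
    (ρW : QuantumWeight.Weight →L[ℂ] QuantumWeight.Weight)
    (hρW : QuantumWeight.IsDensityOperator ρW)
    (U : QuantumWeight.Composite ι →L[ℂ] QuantumWeight.Composite ι)
    (hU : QuantumWeight.IsProtocol ε U) :
    -- `γ` is the factor by which the map to the control-marginal state damps the coherences
    (∀ i j, QuantumWeight.controlMarginal ε ρS ρW i j =
      QuantumWeight.dumping ρW (ε j - ε i) * ρS i j) ∧
    -- the time-state distribution is invariant under the protocol
    QuantumWeight.timeDensity (QuantumWeight.finalWeight U ρS ρW) =ᵐ[volume]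
      QuantumWeight.timeDensity ρW ∧
    -- the bound for the initial standard deviation of the energy
    ENNReal.ofReal (1 / Real.pi) *
        (⨆ ω ∈ Set.Ioi (0 : ℝ), ENNReal.ofReal (ω * ‖QuantumWeight.dumping ρW ω‖)) ≤
      QuantumWeight.energyStd ρW ∧
    -- the bound for the final standard deviation of the energy
    ENNReal.ofReal (1 / Real.pi) *
        (⨆ ω ∈ Set.Ioi (0 : ℝ), ENNReal.ofReal (ω * ‖QuantumWeight.dumping ρW ω‖)) ≤
      QuantumWeight.energyStd (QuantumWeight.finalWeight U ρS ρW) := by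
  have h3 := (QuantumWeight.isDensityOperator_finalWeight hρS hρW
    hU.unitary).iSup_dumping_le_energyStd
  rw [QuantumWeight.dumping_finalWeight hρS hρW hU] at h3
  exact ⟨QuantumWeight.controlMarginal_apply ε ρS hρW,
    QuantumWeight.timeDensity_finalWeight hρS hρW hU, hρW.iSup_dumping_le_energyStd, h3⟩
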